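/- **Setting.** Let $A,B$ be process templates: for $U\in\{A,B\}$, $U$ has a finite state set $Q_U$ with an initial state $\mathsf{init}_U$, a finite input alphabet $\Sigma_U$, and a guarded transition relation $\delta_U\subseteq Q_U\times\Sigma_U\times\mathcal P(Q_A\,\dot\cup\,Q_B)\times Q_U$; write $|B|=|Q_B|$, and call $B$ closed here if $|\Sigma_B|\le 1$. The disjunctive system $(A,B)^{(1,n)}$ has one $A$-process and $B$-processes $B_1,\dots,B_n$. In a global state $s$ with global input $e$, a local transition $(s(p),e(p),g,q')$ of a process $p$ is enabled iff some process $p'\ne p$ has $s(p')\in g$; $p$ is enabled if one of its transitions is, and disabled otherwise. In each step exactly one process moves, along an enabled transition, and the input of every process that does not move stays the same (a process that moves may get any new input). A run starts with all processes in their initial states, with arbitrary inputs, and either is infinite or ends in a state and input for which all processes are disabled; no fairness is assumed. The system has a global deadlock if it has a finite run, a local deadlock if it has an infinite run on which some process is disabled from some moment on, and a deadlock if it has a local or a global deadlock. A number $c\ge1$ is a cutoff for deadlock detection for $(A,B)$ if for all $n\ge c$: $(A,B)^{(1,c)}$ has a deadlock iff $(A,B)^{(1,n)}$ has a deadlock.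 **Statement.** For all process templates $A,B$: 1. for every $n>|B|+2$: if $(A,B)^{(1,n)}$ has a local deadlock, then so does $(A,B)^{(1,|B|+2)}$; 2. for every $n>2|B|-1$: if $(A,B)^{(1,n)}$ has a global deadlock, then so does $(A,B)^{(1,2|B|-1)}$; 3. if $|B|\ge 2$ or $B$ is closed, then for every $n>2|B|-1$: if $(A,B)^{(1,n)}$ has a deadlock, then so does $(A,B)^{(1,2|B|-1)}$; 4. for every $n\ge|B|+1$: if $(A,B)^{(1,n)}$ has a deadlock, then so does $(A,B)^{(1,n+1)}$; 5. if $|B|\ge2$, then $2|B|-1$ is a cutoff for deadlock detection for $(A,B)$. The cutoff is asymptotically tight: for every $k\ge2$ there are process templates $A,B$ with $|B|=k$ such that $(A,B)^{(1,k-1)}$ has no deadlock but $(A,B)^{(1,k)}$ has one; hence every cutoff for deadlock detection for this $(A,B)$ is at least $k=|B|$. -/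

import Mathlib

namespace GuardedSystem

/-- A process template with state set `Q`, input alphabet `I`, and transitions guarded by
sets of local states taken from `L`; `trans q σ g q'` is the transition from `q` to `q'` for
input `σ` with guard `g`. In a system of type `(A, B)`, one has `L = QA ⊕ QB`, the disjoint
union of the state sets of both templates. -/
structure Template (Q I L : Type*) where
  init : Q
  trans : Q → I → Set L → Q → Prop

/-- The processes of `(A, B)^(1,n)`: one `A`-process and `n` `B`-processes. -/
inductive Proc (n : ℕ) : Type
  | a : Proc n
  | b : Fin n → Proc n

/-- Global states of `(A, B)^(1,n)`. -/
abbrev State (QA QB : Type*) (n : ℕ) := QA × (Fin n → QB)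

/-- Global inputs of `(A, B)^(1,n)`. -/
abbrev Input (IA IB : Type*) (n : ℕ) := IA × (Fin n → IB)

section

variable {QA QB IA IB : Type*} {n : ℕ}

/-- The local state `s(p)`. -/
def localState (s : State QA QB n) : Proc n → QA ⊕ QB
  | .a => .inl s.1
  | .b i => .inr (s.2 i)

/-- The local input `e(p)`. -/
def localInput (e : Input IA IB n) : Proc n → IA ⊕ IB
  | .a => .inl e.1
  | .b i => .inr (e.2 i)

/-- Disjunctive guards: `(s, p) ⊨ g` iff some process other than `p` is in a state of `g`. -/
def Sat (s : State QA QB n) (p : Proc n) (g : Set (QA ⊕ QB)) : Prop :=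
  ∃ p', p' ≠ p ∧ localState s p' ∈ g

variable (A : Template QA IA (QA ⊕ QB)) (B : Template QB IB (QA ⊕ QB))

/-- The global transition from `s` to `s'` for input `e` in which exactly process `p` moves,
along one of its local transitions that is enabled for `s` and `e`. -/
def Step (s : State QA QB n) (e : Input IA IB n) (p : Proc n) (s' : State QA QB n) : Prop :=
  match p with
  | .a => ∃ g q', A.trans s.1 e.1 g q' ∧ Sat s .a g ∧ s' = (q', s.2)
  | .b i => ∃ g q', B.trans (s.2 i) (e.2 i) g q' ∧ Sat s (.b i) g ∧
      s' = (s.1, Function.update s.2 i q')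

/-- Process `p` has at least one transition that is enabled for `s` and `e`. -/
def Enabled (s : State QA QB n) (e : Input IA IB n) (p : Proc n) : Prop :=
  match p with
  | .a => ∃ g q', A.trans s.1 e.1 g q' ∧ Sat s .a g
  | .b i => ∃ g q', B.trans (s.2 i) (e.2 i) g q' ∧ Sat s (.b i) g

/-- A configuration `(s, e, p)`; `mover = none` stands for the special symbol `⊥`. -/
structure Config (QA QB IA IB : Type*) (n : ℕ) where
  state : State QA QB n
  input : Input IA IB n
  mover : Option (Proc n)

/-- The configuration `c` may be followed by `c'` on a path: the process named by `c` moves,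
and the environment keeps the inputs of all other processes. -/
def Next (c c' : Config QA QB IA IB n) : Prop :=
  ∃ p, c.mover = some p ∧ Step A B c.state c.input p c'.state ∧
    ∀ p', p' ≠ p → localInput c'.input p' = localInput c.input p'

/-- The global initial state. -/
def initState (n : ℕ) : State QA QB n := (A.init, fun _ => B.init)

/-- Infinite runs. -/
def IsInfiniteRun (x : ℕ → Config QA QB IA IB n) : Prop :=
  (x 0).state = initState A B n ∧ ∀ t, Next A B (x t) (x (t + 1))

/-- Finite runs: they end in a configuration `(s, e, ⊥)`, in which all processes are disabled.
In all earlier configurations, some process moves and hence is enabled. -/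
def IsFiniteRun {d : ℕ} (x : Fin (d + 1) → Config QA QB IA IB n) : Prop :=
  (x 0).state = initState A B n ∧
  (∀ t : Fin d, Next A B (x t.castSucc) (x t.succ)) ∧
  (x (Fin.last d)).mover = none ∧
  ∀ p, ¬ Enabled A B (x (Fin.last d)).state (x (Fin.last d)).input p

/-- The disjunctive system `(A, B)^(1,n)` has a globally deadlocked (that is, finite) run. -/
def HasGlobalDeadlock (n : ℕ) : Prop :=
  ∃ (d : ℕ) (x : Fin (d + 1) → Config QA QB IA IB n), IsFiniteRun A B x

/-- The disjunctive system `(A, B)^(1,n)` has an infinite run on which some process is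
disabled from some moment on. -/
def HasLocalDeadlock (n : ℕ) : Prop :=
  ∃ x : ℕ → Config QA QB IA IB n, IsInfiniteRun A B x ∧
    ∃ p t, ∀ t' ≥ t, ¬ Enabled A B (x t').state (x t').input p

/-- The disjunctive system `(A, B)^(1,n)` has a deadlocked run. -/
def HasDeadlock (n : ℕ) : Prop := HasLocalDeadlock A B n ∨ HasGlobalDeadlock A B n

/-- `c ≥ 1` is a cutoff for deadlock detection for the type `(A, B)`. -/
def IsDeadlockCutoff (c : ℕ) : Prop :=
  1 ≤ c ∧ ∀ n ≥ c, (HasDeadlock A B c ↔ HasDeadlock A B n)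

end

end GuardedSystem

/-! A disjunctive guard asks for a single witness in another process. A run can therefore be
imitated by a different number of `B`-processes if every local state that could serve as a witness
is held by some process that is not moving (`Simulates`). Several processes may copy one local move,
one after the other.

The simulation `IsPath.exists_simulation` copies the processes outside a set `W` individually. It
spends one process on each `r` in `QB`: this process enters `r` with the first member of `W` to do
so, waits there, and leaves with the last one (flooding with evacuation). So it is always in a state
that `W` occupies now or later, and adds no witness that the original run lacks.

For a local deadlock of a `B`-process `d`, take `W` to be all other `B`-processes; one further copy
of a process that moves infinitely often keeps the run infinite, for a total of `|B| + 2`. For a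
global deadlock, `W` consists of the processes that share their final state with another one; at
most `|B| - 1` are left over, for a total of `2|B| - 1`. This dominates `|B| + 2` once `|B| ≥ 3`;
`|B| = 2` and the closed case `|B| = 1` need separate arguments. Monotonicity comes from duplicating
one process.

Tightness: in `tightB` a process advances only if another one shares its state, so an occupied state
is never abandoned. Reaching the last state then needs as many processes as there are states. -/

namespace GuardedSystem

open Relation

/-! ### Eliminating inputs: runs from sequences of moves -/

section

variable {QA QB IA IB : Type*} {n N : ℕ}
variable (A : Template QA IA (QA ⊕ QB)) (B : Template QB IB (QA ⊕ QB))

/-- Process `p` can move from `s` to `s'` for some choice of its input. -/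
def Move (s : State QA QB n) (p : Proc n) (s' : State QA QB n) : Prop :=
  match p with
  | .a => ∃ σ g q', A.trans s.1 σ g q' ∧ Sat s .a g ∧ s' = (q', s.2)
  | .b i => ∃ σ g q', B.trans (s.2 i) σ g q' ∧ Sat s (.b i) g ∧
      s' = (s.1, Function.update s.2 i q')

/-- Some process `p` with `C s p` can move from `s` to `s'`. -/
def MoveWith (C : State QA QB n → Proc n → Prop) (s s' : State QA QB n) : Prop :=
  ∃ p, C s p ∧ Move A B s p s'

/-- Global states that are reachable from the initial state. -/
def Reachable (s : State QA QB n) : Prop :=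
  ReflTransGen (MoveWith A B fun _ _ => True) (initState A B n) s

variable {A B}

theorem Step.move {s s' : State QA QB n} {e : Input IA IB n} {p : Proc n}
    (h : Step A B s e p s') : Move A B s p s' := by
  cases p with
  | a => obtain ⟨g, q', h⟩ := h; exact ⟨e.1, g, q', h⟩
  | b i => obtain ⟨g, q', h⟩ := h; exact ⟨e.2 i, g, q', h⟩

theorem Step.enabled {s s' : State QA QB n} {e : Input IA IB n} {p : Proc n}
    (h : Step A B s e p s') : Enabled A B s e p := by
  cases p with
  | a => obtain ⟨g, q', h, h', -⟩ := h; exact ⟨g, q', h, h'⟩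
  | b i => obtain ⟨g, q', h, h', -⟩ := h; exact ⟨g, q', h, h'⟩

theorem Move.exists_step {s s' : State QA QB n} {p : Proc n} (h : Move A B s p s')
    (e : Input IA IB n) : ∃ e' : Input IA IB n,
      (∀ p', p' ≠ p → localInput e p' = localInput e' p') ∧ Step A B s e' p s' := by
  classical
  cases p with
  | a =>
    obtain ⟨σ, g, q', h⟩ := h
    refine ⟨(σ, e.2), fun p' hp' => ?_, g, q', h⟩
    cases p' with
    | a => exact absurd rfl hp'
    | b i => rfl
  | b i =>
    obtain ⟨σ, g, q', h⟩ := h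
    refine ⟨(e.1, Function.update e.2 i σ), fun p' hp' => ?_, g, q', ?_⟩
    · cases p' with
      | a => rfl
      | b j =>
        have : j ≠ i := fun hj => hp' (by rw [hj])
        simp [localInput, this]
    · simpa using h

theorem Step.congr_input {s s' : State QA QB n} {e e' : Input IA IB n} {p : Proc n}
    (he : localInput e p = localInput e' p) (h : Step A B s e p s') : Step A B s e' p s' := by
  cases p with
  | a => simp only [localInput, Sum.inl.injEq] at he; simpa [Step, ← he] using h
  | b i => simp only [localInput, Sum.inr.injEq] at he; simpa [Step, ← he] using h

theorem Enabled.congr_input {s : State QA QB n} {e e' : Input IA IB n} {p : Proc n}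
    (he : localInput e p = localInput e' p) (h : Enabled A B s e p) : Enabled A B s e' p := by
  cases p with
  | a => simp only [localInput, Sum.inl.injEq] at he; simpa [Enabled, ← he] using h
  | b i => simp only [localInput, Sum.inr.injEq] at he; simpa [Enabled, ← he] using h

theorem exists_finite_path {s s' : State QA QB n}
    (h : ReflTransGen (MoveWith A B fun _ _ => True) s s') (e : Input IA IB n) :
    ∃ (d : ℕ) (x : Fin (d + 1) → Config QA QB IA IB n), (x 0).state = s ∧
      (∀ t : Fin d, Next A B (x t.castSucc) (x t.succ)) ∧ x (Fin.last d) = ⟨s', e, none⟩ := by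
  induction h using ReflTransGen.head_induction_on with
  | refl => exact ⟨0, fun _ => ⟨s', e, none⟩, rfl, fun t => t.elim0, rfl⟩
  | head h _ ih =>
    obtain ⟨p, -, h⟩ := h
    obtain ⟨d, x, hx0, hx, hl⟩ := ih
    obtain ⟨e', he', hst⟩ := h.exists_step (x 0).input
    refine ⟨d + 1, Fin.cons ⟨_, e', some p⟩ x, rfl, fun t => ?_, ?_⟩
    · induction t using Fin.cases with
      | zero => exact ⟨p, rfl, by simpa [hx0] using hst, by simpa using he'⟩
      | succ t => simpa [← Fin.succ_castSucc] using hx t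
    · simpa [← Fin.succ_last] using hl

theorem exists_prepend {s : State QA QB n} (x : ℕ → Config QA QB IA IB n)
    (hx : ∀ t, Next A B (x t) (x (t + 1)))
    (h : ReflTransGen (MoveWith A B fun _ _ => True) s (x 0).state) :
    ∃ (k : ℕ) (y : ℕ → Config QA QB IA IB n), (y 0).state = s ∧
      (∀ t, Next A B (y t) (y (t + 1))) ∧ ∀ t, y (k + t) = x t := by
  induction h using ReflTransGen.head_induction_on with
  | refl => exact ⟨0, x, rfl, hx, fun t => by rw [Nat.zero_add]⟩
  | head h _ ih =>
    obtain ⟨p, -, h⟩ := h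
    obtain ⟨k, y, hy0, hy, hk⟩ := ih
    obtain ⟨e', he', hst⟩ := h.exists_step (y 0).input
    rename_i a _ _
    let w (t : ℕ) : Config QA QB IA IB n := Nat.casesOn t ⟨a, e', some p⟩ y
    refine ⟨k + 1, w, rfl, fun t => ?_, fun t => ?_⟩
    · cases t with
      | zero => exact ⟨p, rfl, by rw [← hy0] at hst; exact hst, he'⟩
      | succ t => exact hy t
    · rw [show k + 1 + t = (k + t) + 1 by omega]; exact hk t

/-- The environment may choose a new input only when a process moves, so each process must hold the
input for its next move well in advance. A process that never moves can keep any prescribed input,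
which is what a deadlocked process needs. -/
theorem exists_infinite_path {z : ℕ → State QA QB n} {P : ℕ → Proc n}
    (hz : ∀ t, Move A B (z t) (P t) (z (t + 1))) (e : Input IA IB n) :
    ∃ x : ℕ → Config QA QB IA IB n, (∀ t, (x t).state = z t) ∧
      (∀ t, Next A B (x t) (x (t + 1))) ∧
      ∀ p, (∀ t, P t ≠ p) → ∀ t, localInput (x t).input p = localInput e p := by
  classical
  choose E hE hst using fun t => (hz t).exists_step e
  -- The input required at the next time, from `t` on, at which `p` moves; the default `e` if there
  -- is none.
  let pick (t : ℕ) (p : Proc n) : Input IA IB n :=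
    if h : ∃ t', t ≤ t' ∧ P t' = p then E (Nat.find h) else e
  let inp (t : ℕ) : Input IA IB n := ((pick t .a).1, fun i => (pick t (.b i)).2 i)
  have hinp (t : ℕ) (p : Proc n) : localInput (inp t) p = localInput (pick t p) p := by
    cases p <;> rfl
  have hpick (t : ℕ) : pick t (P t) = E t := by
    have h : ∃ t', t ≤ t' ∧ P t' = P t := ⟨t, le_rfl, rfl⟩
    have : Nat.find h = t := le_antisymm (Nat.find_min' h ⟨le_rfl, rfl⟩) (Nat.find_spec h).1
    simp only [pick, dif_pos h, this]
  have hpick' (t : ℕ) (p : Proc n) (hp : p ≠ P t) : pick (t + 1) p = pick t p := by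
    have hiff (t' : ℕ) : (t + 1 ≤ t' ∧ P t' = p) ↔ (t ≤ t' ∧ P t' = p) := by
      refine ⟨fun h => ⟨by omega, h.2⟩, fun h => ⟨?_, h.2⟩⟩
      rcases h.1.eq_or_lt with rfl | h'
      · exact absurd h.2.symm hp
      · exact h'
    simp only [pick, hiff]
  refine ⟨fun t => ⟨z t, inp t, some (P t)⟩, fun _ => rfl, fun t => ⟨P t, rfl, ?_, ?_⟩, ?_⟩
  · exact (hst t).congr_input (by rw [hinp, hpick])
  · intro p' hp'
    simp only [hinp, hpick' t p' hp']
  · intro p hp t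
    have h : ¬ ∃ t', t ≤ t' ∧ P t' = p := fun ⟨t', _, h⟩ => hp t' h
    simp only [hinp, pick, dif_neg h]

theorem hasGlobalDeadlock_of_reachable {s : State QA QB n} (hs : Reachable A B s)
    (e : Input IA IB n) (he : ∀ p, ¬ Enabled A B s e p) : HasGlobalDeadlock A B n := by
  obtain ⟨d, x, h0, hx, hl⟩ := exists_finite_path hs e
  exact ⟨d, x, h0, hx, by rw [hl], by simpa [hl] using he⟩

/-- Moves of processes other than `p` from states in which `p` is disabled for the input `e`. -/
abbrev StuckMove (A : Template QA IA (QA ⊕ QB)) (B : Template QB IB (QA ⊕ QB))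
    (e : Input IA IB n) (p : Proc n) : State QA QB n → State QA QB n → Prop :=
  MoveWith A B fun s p' => ¬ Enabled A B s e p ∧ p' ≠ p

theorem hasLocalDeadlock_of_chain {z : ℕ → State QA QB n} (e : Input IA IB n) (p : Proc n)
    (h0 : Reachable A B (z 0)) (hz : ∀ t, StuckMove A B e p (z t) (z (t + 1))) :
    HasLocalDeadlock A B n := by
  choose P hP hmove using hz
  obtain ⟨x, hxs, hx, hxe⟩ := exists_infinite_path hmove e
  obtain ⟨k, y, hy0, hy, hk⟩ := exists_prepend (s := initState A B n) x hx (by rw [hxs]; exact h0)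
  refine ⟨y, ⟨hy0, hy⟩, p, k, fun t' ht' hen => ?_⟩
  obtain ⟨t, rfl⟩ := Nat.exists_eq_add_of_le ht'
  rw [hk, hxs] at hen
  exact (hP t).1 (hen.congr_input (hxe p (fun t => (hP t).2) t))

/-- A relation that can be followed forever from `s 0`, by way of the states `s t`. -/
theorem exists_chain_of_frequently {α : Type*} {R : α → α → Prop} {Y : ℕ → α}
    (h : ∀ t, ReflTransGen R (Y t) (Y (t + 1)))
    (h' : ∀ t, ∃ t' ≥ t, TransGen R (Y t') (Y (t' + 1))) :
    ∃ z : ℕ → α, z 0 = Y 0 ∧ ∀ t, R (z t) (z (t + 1)) := by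
  have hmono (t t' : ℕ) (htt : t ≤ t') : ReflTransGen R (Y t) (Y t') := by
    induction t', htt using Nat.le_induction with
    | base => exact .refl
    | succ m _ ih => exact ih.trans (h m)
  -- Nonempty segments recur, so every element of `S` has an `R`-successor in `S`; iterating a
  -- choice of successors gives the chain.
  let S : Set α := {a | ∃ t, ReflTransGen R a (Y t)}
  have hS (a : S) : ∃ b : S, R a b := by
    obtain ⟨a, t, ht⟩ := a
    obtain ⟨t', ht', h1⟩ := h' t
    obtain ⟨b, hab, hb⟩ := TransGen.head'_iff.1 (TransGen.trans_right (ht.trans (hmono t t' ht')) h1)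
    exact ⟨⟨b, _, hb⟩, hab⟩
  choose f hf using hS
  refine ⟨fun t => (f^[t] ⟨Y 0, 0, .refl⟩ : S), rfl, fun t => ?_⟩
  simp only [Function.iterate_succ_apply']
  exact hf _

/-! ### Input-free paths; pauses let finite and infinite runs be treated alike -/

/-- Sequences of moves in which the system may also pause (`P t = none`). -/
structure IsPath (A : Template QA IA (QA ⊕ QB)) (B : Template QB IB (QA ⊕ QB))
    (s : ℕ → State QA QB n) (P : ℕ → Option (Proc n)) : Prop where
  init : s 0 = initState A B n
  pause : ∀ t, P t = none → s (t + 1) = s t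
  move : ∀ t p, P t = some p → Move A B (s t) p (s (t + 1))

section path

variable {s : ℕ → State QA QB n} {P : ℕ → Option (Proc n)}

theorem IsPath.fst_succ (hs : IsPath A B s P) {t : ℕ} (h : P t ≠ some .a) :
    (s (t + 1)).1 = (s t).1 := by
  rcases hP : P t with _ | p
  · rw [hs.pause t hP]
  · cases p with
    | a => exact absurd hP h
    | b i =>
      obtain ⟨σ, g, q', -, -, h⟩ := hs.move t _ hP
      rw [h]

theorem IsPath.snd_succ (hs : IsPath A B s P) {t : ℕ} {j : Fin n} (h : P t ≠ some (.b j)) :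
    (s (t + 1)).2 j = (s t).2 j := by
  rcases hP : P t with _ | p
  · rw [hs.pause t hP]
  · cases p with
    | a =>
      obtain ⟨σ, g, q', -, -, h⟩ := hs.move t _ hP
      rw [h]
    | b i =>
      obtain ⟨σ, g, q', -, -, h'⟩ := hs.move t _ hP
      have : j ≠ i := fun hj => h (by rw [hj, hP])
      simp [h', this]

theorem IsPath.localState_eq (hs : IsPath A B s P) {T : ℕ} {p : Proc n}
    (h : ∀ t ≥ T, P t ≠ some p) {t : ℕ} (ht : T ≤ t) :
    localState (s t) p = localState (s T) p := by
  induction t, ht using Nat.le_induction with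
  | base => rfl
  | succ t ht ih =>
    rw [← ih]
    cases p with
    | a => simp only [localState, hs.fst_succ (h t ht)]
    | b j => simp only [localState, hs.snd_succ (h t ht)]

theorem HasGlobalDeadlock.exists_path (h : HasGlobalDeadlock A B n) :
    ∃ (s : ℕ → State QA QB n) (P : ℕ → Option (Proc n)) (d : ℕ) (e : Input IA IB n),
      IsPath A B s P ∧ (∀ t ≥ d, s t = s d) ∧ ∀ p, ¬ Enabled A B (s d) e p := by
  obtain ⟨d, x, h0, hx, hl, hd⟩ := h
  have hlt (t : ℕ) : min t d < d + 1 := by omega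
  let y (t : ℕ) : Config QA QB IA IB n := x ⟨min t d, hlt t⟩
  have hy (t : ℕ) (ht : d ≤ t) : y t = x (Fin.last d) := by
    simp only [y]; congr 1; ext; simp [ht]
  have hn (t : ℕ) (ht : t < d) : Next A B (y t) (y (t + 1)) := by
    have h1 : y t = x (Fin.castSucc ⟨t, ht⟩) := by
      simp only [y]; congr 1; ext; simp [ht.le]
    have h2 : y (t + 1) = x (Fin.succ ⟨t, ht⟩) := by
      simp only [y]; congr 1; ext; simp [Nat.succ_le_of_lt ht]
    rw [h1, h2]; exact hx _
  refine ⟨fun t => (y t).state, fun t => (y t).mover, d, (y d).input, ⟨?_, ?_, ?_⟩, ?_, ?_⟩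
  · rw [← h0]; simp only [y]; congr 2
  · intro t ht
    rcases lt_or_ge t d with h | h
    · obtain ⟨p, hp, -⟩ := hn t h
      simp [hp] at ht
    · simp only [hy t h, hy (t + 1) (by omega)]
  · intro t p hp
    rcases lt_or_ge t d with h | h
    · obtain ⟨p', hp', hst, -⟩ := hn t h
      obtain rfl : p' = p := by simpa [hp'] using hp
      exact hst.move
    · simp [hy t h, hl] at hp
  · intro t ht
    simp only [hy t ht, hy d le_rfl]
  · simpa only [hy d le_rfl] using hd

/-- A disabled process does not move, so its input is frozen from `T` on, and one fixed `e`
witnesses the deadlock at all later times. -/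
theorem HasLocalDeadlock.exists_path (h : HasLocalDeadlock A B n) :
    ∃ (s : ℕ → State QA QB n) (P : ℕ → Option (Proc n)) (T : ℕ) (e : Input IA IB n) (p : Proc n),
      IsPath A B s P ∧ (∀ t, P t ≠ none) ∧
      ∀ t ≥ T, ¬ Enabled A B (s t) e p ∧ P t ≠ some p := by
  obtain ⟨x, ⟨h0, hx⟩, p, T, hT⟩ := h
  have hmv (t : ℕ) (ht : T ≤ t) : (x t).mover ≠ some p := by
    intro hp
    obtain ⟨p', hp', hst, -⟩ := hx t
    obtain rfl : p' = p := by simpa [hp'] using hp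
    exact hT t ht hst.enabled
  have hin (t : ℕ) (ht : T ≤ t) : localInput (x T).input p = localInput (x t).input p := by
    induction t, ht using Nat.le_induction with
    | base => rfl
    | succ t ht ih =>
      obtain ⟨p', hp', -, h⟩ := hx t
      rw [ih, h p fun h => hmv t ht (by rw [hp', h])]
  refine ⟨fun t => (x t).state, fun t => (x t).mover, T, (x T).input, p, ⟨h0, ?_, ?_⟩, ?_, ?_⟩
  · intro t ht
    obtain ⟨p', hp', -⟩ := hx t
    simp [hp'] at ht
  · intro t p' hp
    obtain ⟨p', hp', hst, -⟩ := hx t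
    obtain rfl : p' = _ := by simpa [hp'] using hp
    exact hst.move
  · intro t ht
    obtain ⟨p', hp', -⟩ := hx t
    simp [hp'] at ht
  · exact fun t ht => ⟨fun hen => hT t ht (hen.congr_input (hin t ht)), hmv t ht⟩

/-! ### Simulating a path with another number of processes -/

/-- At each time, each `B`-process of the new system either stays where it is or copies the local
transition of the `B`-process that moves on the given path. Local states of processes that do not
move on the path are occupied by processes that do not move in the new system. -/
structure Simulates (B : Template QB IB (QA ⊕ QB)) (s : ℕ → State QA QB n)
    (P : ℕ → Option (Proc n)) (loc : ℕ → Fin N → QB) (mv : ℕ → Fin N → Prop) : Prop where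
  init : ∀ i, loc 0 i = B.init
  stay : ∀ t i, ¬ mv t i → loc (t + 1) i = loc t i
  move : ∀ t i, mv t i → ∃ j, P t = some (.b j) ∧ loc t i = (s t).2 j ∧
    loc (t + 1) i = (s (t + 1)).2 j
  witness : ∀ t p j, P t = some p → p ≠ .b j → ∃ i, ¬ mv t i ∧ loc t i = (s t).2 j

variable {loc : ℕ → Fin N → QB} {mv : ℕ → Fin N → Prop}

/-- One original move becomes a sequence of moves of all its copiers. The guard stays true
throughout, because its witness is either `A` or matched by a process that does not move in this
round. The condition `C` has to hold in the intermediate states too, hence the quantification over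
mixtures `f` of old and new positions. -/
theorem Simulates.moveWith (h : Simulates B s P loc mv) (hs : IsPath A B s P)
    {C : State QA QB N → Proc N → Prop} (t : ℕ)
    (hC : ∀ f p, (∀ i, f i = loc t i ∨ f i = loc (t + 1) i) →
      (P t = some .a ∧ p = .a ∨ ∃ i, mv t i ∧ p = .b i) → C ((s t).1, f) p) :
    ReflTransGen (MoveWith A B C) ((s t).1, loc t) ((s (t + 1)).1, loc (t + 1)) ∧
    ((P t = some .a ∨ ∃ i, mv t i) →
      TransGen (MoveWith A B C) ((s t).1, loc t) ((s (t + 1)).1, loc (t + 1))) := by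
  classical
  have hloc (hno : ∀ i, ¬ mv t i) : loc (t + 1) = loc t := funext fun i => h.stay t i (hno i)
  rcases hP : P t with _ | p
  · have hno : ∀ i, ¬ mv t i := fun i hi => by
      obtain ⟨j, hj, -⟩ := h.move t i hi
      simp [hP] at hj
    rw [hs.pause t hP, hloc hno]
    exact ⟨.refl, fun h => by simp [hno] at h⟩
  cases p with
  | a =>
    have hno : ∀ i, ¬ mv t i := fun i hi => by
      obtain ⟨j, hj, -⟩ := h.move t i hi
      simp [hP] at hj
    have : MoveWith A B C ((s t).1, loc t) ((s (t + 1)).1, loc (t + 1)) := by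
      obtain ⟨σ, g, q', htr, ⟨p', hp', hg⟩, heq⟩ := hs.move t _ hP
      refine ⟨.a, hC _ _ (fun i => .inl rfl) (.inl ⟨hP, rfl⟩), σ, g, q', htr, ?_, ?_⟩
      · cases p' with
        | a => exact absurd rfl hp'
        | b j =>
          obtain ⟨i, -, hi⟩ := h.witness t _ j hP (by simp)
          exact ⟨.b i, by simp, by simpa [localState, hi] using hg⟩
      · rw [heq, hloc hno]
    exact ⟨.single this, fun _ => .single this⟩
  | b j =>
    have hA : (s (t + 1)).1 = (s t).1 := hs.fst_succ (by simp [hP])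
    -- The intermediate state in which exactly the copiers in `S` have already moved.
    let f (S : Finset (Fin N)) : Fin N → QB := fun i => if i ∈ S then loc (t + 1) i else loc t i
    have hf (S : Finset (Fin N)) (i : Fin N) : f S i = loc t i ∨ f S i = loc (t + 1) i := by
      by_cases hi : i ∈ S <;> simp [f, hi]
    have hstep (S : Finset (Fin N)) (hS : ∀ i ∈ S, mv t i) (i : Fin N) (hi : mv t i)
        (hiS : i ∉ S) : MoveWith A B C ((s t).1, f S) ((s t).1, f (insert i S)) := by
      refine ⟨.b i, hC _ _ (hf S) (.inr ⟨i, hi, rfl⟩), ?_⟩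
      obtain ⟨σ, g, q', htr, ⟨p', hp', hg⟩, heq⟩ := hs.move t _ hP
      obtain ⟨j', hj', hl, hl'⟩ := h.move t i hi
      obtain rfl : j = j' := by simpa [hP] using hj'
      refine ⟨σ, g, q', by simpa [f, hiS, hl] using htr, ?_, ?_⟩
      · cases p' with
        | a => exact ⟨.a, by simp, hg⟩
        | b j'' =>
          obtain ⟨i', hi', hl''⟩ := h.witness t _ j'' hP hp'.symm
          have hi'S : i' ∉ S := fun hh => hi' (hS i' hh)
          refine ⟨.b i', fun hh => hi' ?_, by simpa [localState, f, hi'S, hl''] using hg⟩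
          rw [Proc.b.inj hh]; exact hi
      · refine Prod.ext rfl (funext fun i' => ?_)
        by_cases hii : i' = i
        · subst hii; simp [f, hl', heq]
        · simp [f, hii]
    have hrtg (S : Finset (Fin N)) (hS : ∀ i ∈ S, mv t i) :
        ReflTransGen (MoveWith A B C) ((s t).1, loc t) ((s t).1, f S) := by
      induction S using Finset.induction_on with
      | empty => simp only [f, Finset.notMem_empty, if_false]; exact .refl
      | insert i S hi ih =>
        have hS' : ∀ i ∈ S, mv t i := fun i' hi' => hS i' (by simp [hi'])
        exact (ih hS').tail (hstep S hS' i (hS i (by simp)) hi)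
    have hfin : f (Finset.univ.filter (mv t)) = loc (t + 1) := by
      funext i
      by_cases hi : mv t i
      · simp [f, hi]
      · simp [f, hi, h.stay t i hi]
    rw [hA, ← hfin]
    refine ⟨hrtg _ (by simp), fun hex => ?_⟩
    obtain ⟨i, hi⟩ : ∃ i, mv t i := by simpa using hex
    have hS : ∀ i' ∈ (Finset.univ.filter (mv t)).erase i, mv t i' := by simp
    have := hstep _ hS i hi (by simp)
    rw [Finset.insert_erase (by simp [hi])] at this
    exact .tail' (hrtg _ hS) this

theorem Simulates.reachable (h : Simulates B s P loc mv) (hs : IsPath A B s P) (t : ℕ) :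
    Reachable A B ((s t).1, loc t) := by
  induction t with
  | zero =>
    have : ((s 0).1, loc 0) = initState A B N := by
      rw [hs.init]; exact Prod.ext rfl (funext h.init)
    rw [this]; exact .refl
  | succ t ih => exact ih.trans (h.moveWith hs t (fun _ _ _ _ => trivial)).1

theorem Simulates.hasLocalDeadlock (h : Simulates B s P loc mv) (hs : IsPath A B s P)
    (e : Input IA IB N) (p : Proc N) (T : ℕ)
    (hen : ∀ t ≥ T, ∀ f : Fin N → QB, (∀ i, f i = loc t i ∨ f i = loc (t + 1) i) →
      ¬ Enabled A B ((s t).1, f) e p)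
    (hp : ∀ t ≥ T, ∀ p', (P t = some .a ∧ p' = .a ∨ ∃ i, mv t i ∧ p' = .b i) → p' ≠ p)
    (hinf : ∀ t, ∃ t' ≥ t, P t' = some .a ∨ ∃ i, mv t' i) : HasLocalDeadlock A B N := by
  have key (t : ℕ) := h.moveWith hs (C := fun s p' => ¬ Enabled A B s e p ∧ p' ≠ p) (T + t)
    (fun f p' hf hp' => ⟨hen _ (by omega) f hf, hp _ (by omega) p' hp'⟩)
  obtain ⟨z, hz0, hz⟩ := exists_chain_of_frequently (Y := fun t => ((s (T + t)).1, loc (T + t)))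
    (fun t => (key t).1) (fun t => by
      obtain ⟨t', ht', hh⟩ := hinf (T + t)
      obtain ⟨k, rfl⟩ := Nat.exists_eq_add_of_le (show T ≤ t' by omega)
      exact ⟨k, by omega, (key k).2 hh⟩)
  exact hasLocalDeadlock_of_chain e p (hz0 ▸ h.reachable hs _) hz

end path

end

/-! ### Flooding and evacuation -/

section

variable {QA QB IA IB : Type*} {n N : ℕ}
variable {A : Template QA IA (QA ⊕ QB)} {B : Template QB IB (QA ⊕ QB)}
variable {s : ℕ → State QA QB n} {P : ℕ → Option (Proc n)}

/-- The local state `l t` starts in the initial state; it changes only at times with `m t`, and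
then copies the move of some process in `W`. -/
structure Follows (B : Template QB IB (QA ⊕ QB)) (s : ℕ → State QA QB n)
    (P : ℕ → Option (Proc n)) (W : Set (Fin n)) (l : ℕ → QB) (m : ℕ → Prop) : Prop where
  init : l 0 = B.init
  stay : ∀ t, ¬ m t → l (t + 1) = l t
  move : ∀ t, m t → ∃ j ∈ W, P t = some (.b j) ∧ l t = (s t).2 j ∧ l (t + 1) = (s (t + 1)).2 j

theorem IsPath.follows (hs : IsPath A B s P) {W : Set (Fin n)} {j : Fin n} (hj : j ∈ W) :
    Follows B s P W (fun t => (s t).2 j) (fun t => P t = some (.b j)) where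
  init := by rw [hs.init]; rfl
  stay _ h := hs.snd_succ h
  move _ h := ⟨j, hj, h, rfl, rfl⟩

/-- A process that goes to `r` as soon as some process of `W` does, and stays there. -/
theorem IsPath.exists_flooding (hs : IsPath A B s P) {W : Set (Fin n)} {r : QB}
    (hr : ∃ t, ∃ j ∈ W, (s t).2 j = r) : ∃ l m t₁, Follows B s P W l m ∧
      (∀ t < t₁, ∀ j ∈ W, (s t).2 j ≠ r) ∧ (∀ t ≥ t₁, l t = r ∧ ¬ m t) ∧
      ∃ j ∈ W, ∀ t ≤ t₁, l t = (s t).2 j := by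
  classical
  obtain ⟨j, hj, hjr⟩ := Nat.find_spec hr
  set t₁ := Nat.find hr
  refine ⟨fun t => if t ≤ t₁ then (s t).2 j else r, fun t => t < t₁ ∧ P t = some (.b j), t₁,
    ⟨?_, fun t ht => ?_, ?_⟩, fun t ht j hj hjr => Nat.find_min hr ht ⟨j, hj, hjr⟩, fun t ht => ?_,
    j, hj, fun t ht => by simp [ht]⟩
  · simp [hs.init, initState]
  · rcases lt_trichotomy t t₁ with h | h | h
    · have h' : t + 1 ≤ t₁ := h
      simp only [h', h.le, if_true]
      exact hs.snd_succ fun hp => ht ⟨h, hp⟩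
    · subst h; simp [hjr]
    · have h1 : ¬ t + 1 ≤ t₁ := by omega
      have h2 : ¬ t ≤ t₁ := by omega
      simp [h1, h2]
  · rintro t ⟨ht, hp⟩
    have h' : t + 1 ≤ t₁ := ht
    exact ⟨j, hj, hp, by simp [ht.le], by simp [h']⟩
  · refine ⟨?_, by simp; omega⟩
    rcases ht.eq_or_lt with h | h
    · subst h; simp [hjr]
    · simp [not_le.2 h]

/-- A process that stays in `r` as long as some process of `W` is there, and leaves `r` with the
last one. -/
theorem IsPath.exists_flooding_evacuating (hs : IsPath A B s P) {W : Set (Fin n)} {r : QB}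
    (hr : ∃ t, ∃ j ∈ W, (s t).2 j = r) : ∃ l m, Follows B s P W l m ∧
      (∀ t, ∀ j ∈ W, (s t).2 j = r → P t ≠ some (.b j) → ¬ m t ∧ l t = r) ∧
      ∀ t, ∃ t' ≥ t, ∃ j ∈ W, l t = (s t').2 j := by
  classical
  obtain ⟨l, m, t₁, hf, hlt, hge, j₁, hj₁, hl⟩ := hs.exists_flooding hr
  have hfirst {t : ℕ} {j : Fin n} (hj : j ∈ W) (h : (s t).2 j = r) : t₁ ≤ t := by
    by_contra! hlt'
    exact hlt t hlt' j hj h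
  -- If `W` returns to `r` forever, no evacuation is needed; otherwise there is a last visit, at
  -- time `L`.
  by_cases hinf : ∀ t, ∃ t' ≥ t, ∃ j ∈ W, (s t').2 j = r
  · refine ⟨l, m, hf, fun t j hj hjr _ => (hge t (hfirst hj hjr)).symm, fun t => ?_⟩
    rcases le_total t t₁ with h | h
    · exact ⟨t, le_rfl, j₁, hj₁, hl t h⟩
    · obtain ⟨t', ht', j, hj, hjr⟩ := hinf t
      exact ⟨t', ht', j, hj, by rw [(hge t h).1, hjr]⟩
  obtain ⟨b, hb⟩ : ∃ b, ∀ t, (∃ j ∈ W, (s t).2 j = r) → t ≤ b := by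
    push Not at hinf
    obtain ⟨b, hb⟩ := hinf
    exact ⟨b, fun t ⟨j, hj, h⟩ => by by_contra! hlt'; exact hb t hlt'.le j hj h⟩
  obtain ⟨t₀, h₀⟩ := hr
  have hspec := Nat.findGreatest_spec (P := fun t => ∃ j ∈ W, (s t).2 j = r) (hb t₀ h₀) h₀
  have hmax (t : ℕ) (ht : ∃ j ∈ W, (s t).2 j = r) :
      t ≤ Nat.findGreatest (fun t => ∃ j ∈ W, (s t).2 j = r) b :=
    Nat.le_findGreatest (hb t ht) ht
  set L := Nat.findGreatest (fun t => ∃ j ∈ W, (s t).2 j = r) b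
  obtain ⟨j₂, hj₂, hL⟩ := hspec
  -- A member of `W` in `r` at the last time `L` must move at `L`, so `j₂` is the only one left, and
  -- the flooding process can leave along with it.
  have hmv {j : Fin n} (hj : j ∈ W) (h : (s L).2 j = r) : P L = some (.b j) := by
    by_contra hp
    have := hmax (L + 1) ⟨j, hj, by rw [hs.snd_succ hp, h]⟩
    omega
  have hL1 : t₁ ≤ L := hfirst hj₂ hL
  refine ⟨fun t => if t ≤ L then l t else (s t).2 j₂,
    fun t => (t < L ∧ m t) ∨ (L ≤ t ∧ P t = some (.b j₂)), ⟨?_, fun t ht => ?_, ?_⟩, ?_, fun t => ?_⟩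
  · simpa using hf.init
  · push Not at ht
    rcases lt_or_ge t L with h | h
    · have h' : t + 1 ≤ L := h
      simp only [h', h.le, if_true]
      exact hf.stay t (ht.1 h)
    · have h1 : ¬ t + 1 ≤ L := by omega
      have h2 : L < t := by
        refine lt_of_le_of_ne h fun hh => ?_
        subst hh
        exact ht.2 le_rfl (hmv hj₂ hL)
      simp only [h1, not_le.2 h2, if_false]
      exact hs.snd_succ (ht.2 h)
  · rintro t (⟨h, hm⟩ | ⟨h, hm⟩)
    · have h' : t + 1 ≤ L := h
      simp only [h', h.le, if_true]
      exact hf.move t hm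
    · have h1 : ¬ t + 1 ≤ L := by omega
      refine ⟨j₂, hj₂, hm, ?_, by simp [h1]⟩
      rcases h.eq_or_lt with rfl | h
      · simp [hL, (hge _ hL1).1]
      · simp [not_le.2 h]
  · intro t j hj hjr hp
    have htL := hmax t ⟨j, hj, hjr⟩
    have hne : t ≠ L := by rintro rfl; exact hp (hmv hj hjr)
    have h1 := hge t (hfirst hj hjr)
    refine ⟨?_, by simp [htL, h1.1]⟩
    rintro (⟨-, h⟩ | ⟨h, -⟩)
    · exact h1.2 h
    · omega
  · rcases le_or_gt t t₁ with h | h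
    · exact ⟨t, le_rfl, j₁, hj₁, by simp [h.trans hL1, hl t h]⟩
    rcases le_or_gt t L with h' | h'
    · exact ⟨L, h', j₂, hj₂, by simp [h', (hge t h.le).1, hL]⟩
    · exact ⟨t, le_rfl, j₂, hj₂, by simp [not_le.2 h']⟩

/-- The simulation in which the processes outside `W` are copied one by one, every state visited by
`W` is flooded until `W` evacuates it, and `k` processes copy `w₀`. -/
theorem IsPath.exists_simulation [Finite QB] (hs : IsPath A B s P) (W : Set (Fin n)) {w₀ : Fin n}
    (hw₀ : w₀ ∈ W) {k : ℕ} (hN : Wᶜ.ncard + Nat.card QB + k = N) :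
    ∃ (loc : ℕ → Fin N → QB) (mv : ℕ → Fin N → Prop) (ι : ↥Wᶜ → Fin N),
      Simulates B s P loc mv ∧ Function.Injective ι ∧
      (∀ u t, loc t (ι u) = (s t).2 u ∧ (mv t (ι u) ↔ P t = some (.b u))) ∧
      (∀ i, i ∉ Set.range ι → ∀ t, ∃ t' ≥ t, ∃ w ∈ W, loc t i = (s t').2 w) ∧
      (0 < k → ∃ i, i ∉ Set.range ι ∧ ∀ t, mv t i ↔ P t = some (.b w₀)) := by
  classical
  have hcard : Nat.card ((↥Wᶜ ⊕ QB) ⊕ Fin k) = Nat.card (Fin N) := by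
    rw [Nat.card_sum, Nat.card_sum, Nat.card_coe_set_eq, Nat.card_fin, Nat.card_fin, hN]
  let φ : (↥Wᶜ ⊕ QB) ⊕ Fin k ≃ Fin N := Classical.choice (Finite.card_eq.1 hcard)
  have hflood (r : QB) : ∃ (l : ℕ → QB) (m : ℕ → Prop), Follows B s P W l m ∧
      (∀ t, ∀ j ∈ W, (s t).2 j = r → P t ≠ some (.b j) → ¬ m t ∧ l t = r) ∧
      ∀ t, ∃ t' ≥ t, ∃ j ∈ W, l t = (s t').2 j := by
    by_cases hr : ∃ t, ∃ j ∈ W, (s t).2 j = r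
    · exact hs.exists_flooding_evacuating hr
    · push Not at hr
      -- The process reserved for a state that `W` never visits has nothing to guard; it shadows
      -- `w₀`.
      exact ⟨_, _, hs.follows hw₀, fun t j hj h => absurd h (hr t j hj),
        fun t => ⟨t, le_rfl, w₀, hw₀, rfl⟩⟩
  choose l m hf hguard hocc using hflood
  let loc' (t : ℕ) : (↥Wᶜ ⊕ QB) ⊕ Fin k → QB :=
    Sum.elim (Sum.elim (fun u => (s t).2 u) (fun r => l r t)) (fun _ => (s t).2 w₀)
  let mv' (t : ℕ) : (↥Wᶜ ⊕ QB) ⊕ Fin k → Prop :=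
    Sum.elim (Sum.elim (fun u => P t = some (.b u)) (fun r => m r t)) (fun _ => P t = some (.b w₀))
  have hall (x : (↥Wᶜ ⊕ QB) ⊕ Fin k) :
      Follows B s P Set.univ (fun t => loc' t x) (fun t => mv' t x) := by
    rcases x with (u | r) | i
    · exact hs.follows (Set.mem_univ u.1)
    · refine ⟨(hf r).init, (hf r).stay, fun t h => ?_⟩
      obtain ⟨j, -, h⟩ := (hf r).move t h
      exact ⟨j, trivial, h⟩
    · exact hs.follows (Set.mem_univ w₀)
  refine ⟨fun t i => loc' t (φ.symm i), fun t i => mv' t (φ.symm i), fun u => φ (.inl (.inl u)),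
    ⟨fun i => (hall _).init, fun t i => (hall _).stay t, fun t i h => ?_, fun t p j hP hp => ?_⟩,
    fun u v h => by simpa using h, fun u t => by simp [loc', mv'], fun i hi t => ?_, fun hk => ?_⟩
  · obtain ⟨j, -, h⟩ := (hall _).move t h
    exact ⟨j, h⟩
  · have hPj : P t ≠ some (.b j) := fun h => hp (by simpa [hP] using h)
    by_cases hj : j ∈ W
    · exact ⟨φ (.inl (.inr ((s t).2 j))), by simpa [loc', mv'] using hguard _ t j hj rfl hPj⟩
    · exact ⟨φ (.inl (.inl ⟨j, hj⟩)), by simpa [loc', mv'] using hPj⟩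
  · obtain ⟨x, rfl⟩ := φ.surjective i
    rcases x with (u | r) | i
    · exact absurd ⟨u, rfl⟩ hi
    · simpa [loc'] using hocc r t
    · exact ⟨t, le_rfl, w₀, hw₀, by simp [loc']⟩
  · exact ⟨φ (.inr ⟨0, hk⟩), by simp, by simp [mv']⟩

/-- A disjunctive guard depends on one witness only, so enabledness carries over to any system, of
any size, in which that witness's local state occurs. -/
theorem Enabled.transfer_a {s : State QA QB n} {e : Input IA IB n} (h : Enabled A B s e .a) :
    ∃ i, ∀ {N : ℕ} (s' : State QA QB N) (e' : Input IA IB N), s'.1 = s.1 → e'.1 = e.1 →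
      (∃ j, s'.2 j = s.2 i) → Enabled A B s' e' .a := by
  obtain ⟨g, q', htr, p', hp', hg⟩ := h
  cases p' with
  | a => exact absurd rfl hp'
  | b i =>
    refine ⟨i, fun s' e' hs he ⟨j, hj⟩ => ⟨g, q', by rwa [hs, he], .b j, by simp, ?_⟩⟩
    simpa [localState, hj] using hg

theorem Enabled.transfer_b {s : State QA QB n} {e : Input IA IB n} {i : Fin n}
    (h : Enabled A B s e (.b i)) :
    ∃ p, p ≠ .b i ∧ ∀ {N : ℕ} (s' : State QA QB N) (e' : Input IA IB N) (i' : Fin N),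
      s'.2 i' = s.2 i → e'.2 i' = e.2 i →
      (∃ p', p' ≠ .b i' ∧ localState s' p' = localState s p) → Enabled A B s' e' (.b i') := by
  obtain ⟨g, q', htr, p, hp, hg⟩ := h
  exact ⟨p, hp, fun s' e' i' hs he ⟨p', hp', h⟩ =>
    ⟨g, q', by rwa [hs, he], p', hp', by rwa [h]⟩⟩

instance : Finite (Proc n) :=
  Finite.of_surjective (fun o : Option (Fin n) => o.elim Proc.a Proc.b) fun p => by
    cases p with
    | a => exact ⟨none, rfl⟩
    | b i => exact ⟨some i, rfl⟩

theorem exists_frequently_mover (hP : ∀ t, P t ≠ none) :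
    ∃ p, ∀ t, ∃ t' ≥ t, P t' = some p := by
  by_contra! h
  choose b hb using h
  obtain ⟨M, hM⟩ := (Set.finite_range b).bddAbove
  obtain ⟨p, hp⟩ := Option.ne_none_iff_exists'.1 (hP M)
  exact hb p M (hM ⟨p, rfl⟩) hp

end

/-! ### Bounding local and global deadlocks -/

section

variable {QA QB IA IB : Type*} {n N : ℕ}
variable {A : Template QA IA (QA ⊕ QB)} {B : Template QB IB (QA ⊕ QB)}
variable {s : ℕ → State QA QB n} {P : ℕ → Option (Proc n)}

theorem IsPath.hasLocalDeadlock_a [Finite QB] (hs : IsPath A B s P) (hP : ∀ t, P t ≠ none)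
    {T : ℕ} {e : Input IA IB n} (hT : ∀ t ≥ T, ¬ Enabled A B (s t) e .a ∧ P t ≠ some .a)
    (hN : Nat.card QB + 1 ≤ N) : HasLocalDeadlock A B N := by
  obtain ⟨p, hp⟩ := exists_frequently_mover hP
  cases p with
  | a =>
    obtain ⟨t, ht, h⟩ := hp T
    exact absurd h (hT t ht).2
  | b j =>
    obtain ⟨loc, mv, ι, hsim, -, -, hocc, hcopy⟩ := hs.exists_simulation Set.univ (Set.mem_univ j)
      (k := N - Nat.card QB) (N := N) (by simp; omega)
    have hι (i : Fin N) : i ∉ Set.range ι := by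
      rintro ⟨u, -⟩
      simpa using u.2
    have hfst {t : ℕ} (ht : T ≤ t) : (s t).1 = (s T).1 := by
      simpa [localState] using hs.localState_eq (fun t ht => (hT t ht).2) ht
    refine hsim.hasLocalDeadlock hs (e.1, fun _ => e.2 j) .a T (fun t ht f hf hen => ?_) ?_ ?_
    · obtain ⟨i, hi⟩ := hen.transfer_a
      obtain ⟨t', ht', w, -, hw⟩ : ∃ t' ≥ t, ∃ w ∈ Set.univ, f i = (s t').2 w := by
        rcases hf i with h | h
        · rw [h]; exact hocc i (hι i) t
        · obtain ⟨t', ht', hh⟩ := hocc i (hι i) (t + 1)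
          rw [h]; exact ⟨t', by omega, hh⟩
      exact (hT t' (by omega)).1 (hi _ _ (by rw [hfst ht, hfst (by omega)]) rfl ⟨w, hw.symm⟩)
    · rintro t ht p' (⟨h, -⟩ | ⟨i, -, rfl⟩)
      · exact absurd h (hT t ht).2
      · simp
    -- The flooding processes may all come to rest; the extra copy of `j` keeps the run infinite.
    · obtain ⟨i, -, hi⟩ := hcopy (by omega)
      intro t
      obtain ⟨t', ht', h⟩ := hp t
      exact ⟨t', ht', .inr ⟨i, (hi t').2 h⟩⟩

/-- If the simulated `d` were enabled, the witness would be `A`, in its state at time `t`, or a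
flooding process or copy, in a state that some process other than `d` occupies at a time `t' ≥ t`.
As `d` keeps its state and input, it would be enabled in the original run at `t` or `t'`. No extra
copy is needed if `A` moves infinitely often. -/
theorem IsPath.hasLocalDeadlock_b [Finite QB] (hs : IsPath A B s P)
    {T : ℕ} {e : Input IA IB n} {d w₀ : Fin n} {k : ℕ}
    (hT : ∀ t ≥ T, ¬ Enabled A B (s t) e (.b d) ∧ P t ≠ some (.b d)) (hw₀ : w₀ ≠ d)
    (hinf : (∀ t, ∃ t' ≥ t, P t' = some .a) ∨ (0 < k ∧ ∀ t, ∃ t' ≥ t, P t' = some (.b w₀)))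
    (hN : 1 + Nat.card QB + k = N) : HasLocalDeadlock A B N := by
  obtain ⟨loc, mv, ι, hsim, hinj, hι, hocc, hcopy⟩ := hs.exists_simulation {d}ᶜ (w₀ := w₀)
    (by simpa using hw₀) (k := k) (N := N) (by rw [compl_compl, Set.ncard_singleton]; exact hN)
  have hsnd {t : ℕ} (ht : T ≤ t) : (s t).2 d = (s T).2 d := by
    simpa [localState] using hs.localState_eq (fun t ht => (hT t ht).2) ht
  let u : ↥({d}ᶜᶜ : Set (Fin n)) := ⟨d, by simp⟩
  have hu (i : Fin N) (hi : i ≠ ι u) : i ∉ Set.range ι := by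
    rintro ⟨v, rfl⟩
    have : v = u := Subtype.ext (by simpa using v.2)
    exact hi (by rw [this])
  refine hsim.hasLocalDeadlock hs (e.1, fun _ => e.2 d) (.b (ι u)) T (fun t ht f hf hen => ?_) ?_ ?_
  · have hfu : f (ι u) = (s T).2 d := by
      rcases hf (ι u) with h | h <;> rw [h, (hι u _).1, hsnd (by omega)]
    obtain ⟨p, hp, hi⟩ := hen.transfer_b
    cases p with
    | a => exact (hT t ht).1 (hi _ _ d (by simp [hfu, hsnd ht]) rfl ⟨.a, by simp, rfl⟩)
    | b i =>
      have hi' := hu i (fun h => hp (by rw [h]))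
      obtain ⟨t', ht', w, hw, hw'⟩ : ∃ t' ≥ t, ∃ w ∈ ({d}ᶜ : Set (Fin n)), f i = (s t').2 w := by
        rcases hf i with h | h
        · rw [h]; exact hocc i hi' t
        · obtain ⟨t', ht', hh⟩ := hocc i hi' (t + 1)
          rw [h]; exact ⟨t', by omega, hh⟩
      refine (hT t' (by omega)).1 (hi _ _ d (by simp [hfu, hsnd (ht.trans ht')]) rfl ⟨.b w, ?_, ?_⟩)
      · simpa using hw
      · simp [localState, hw']
  · rintro t ht p' (⟨-, rfl⟩ | ⟨i, hi, rfl⟩)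
    · simp
    · intro h
      rw [Proc.b.inj h] at hi
      exact (hT t ht).2 ((hι u t).2.1 hi)
  · intro t
    rcases hinf with h | ⟨hk, h⟩
    · obtain ⟨t', ht', h⟩ := h t
      exact ⟨t', ht', .inl h⟩
    · obtain ⟨t', ht', h⟩ := h t
      obtain ⟨i, -, hi⟩ := hcopy hk
      exact ⟨t', ht', .inr ⟨i, (hi t').2 h⟩⟩

theorem HasLocalDeadlock.of_card_add_two_le [Finite QB] (hn : 2 ≤ n) (hN : Nat.card QB + 2 ≤ N)
    (h : HasLocalDeadlock A B n) : HasLocalDeadlock A B N := by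
  obtain ⟨s, P, T, e, p, hs, hP, hT⟩ := h.exists_path
  cases p with
  | a => exact hs.hasLocalDeadlock_a hP hT (by omega)
  | b d =>
    obtain ⟨p, hp⟩ := exists_frequently_mover hP
    cases p with
    | a =>
      have : Nontrivial (Fin n) := Fin.nontrivial_iff_two_le.2 hn
      obtain ⟨w₀, hw₀⟩ := exists_ne d
      exact hs.hasLocalDeadlock_b (k := N - Nat.card QB - 1) hT hw₀ (.inl hp) (by omega)
    | b j =>
      have hj : j ≠ d := by
        rintro rfl
        obtain ⟨t, ht, h⟩ := hp T
        exact (hT t ht).2 h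
      exact hs.hasLocalDeadlock_b (k := N - Nat.card QB - 1) hT hj (.inr ⟨by omega, hp⟩) (by omega)

theorem HasGlobalDeadlock.of_two_mul_card_le [Finite QB] (hn : Nat.card QB < n)
    (hN : 2 * Nat.card QB - 1 ≤ N) (h : HasGlobalDeadlock A B n) : HasGlobalDeadlock A B N := by
  classical
  obtain ⟨s, P, d, e, hs, hd, hen⟩ := h.exists_path
  let W : Set (Fin n) := {j | ∃ j', j' ≠ j ∧ (s d).2 j' = (s d).2 j}
  obtain ⟨w₀, hw₀⟩ : ∃ w, w ∈ W := by
    by_contra! h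
    have hinj : Function.Injective (s d).2 := fun i j hij => by
      by_contra hne
      exact h j ⟨i, hne, hij⟩
    have := Nat.card_le_card_of_injective _ hinj
    rw [Nat.card_fin] at this
    omega
  -- Processes outside `W` have pairwise distinct final states, none of them equal to that of `w₀`.
  have hU : Wᶜ.ncard < Nat.card QB := by
    have hinj : Function.Injective fun u : ↥Wᶜ => (s d).2 u := fun u v huv => by
      by_contra hne
      exact v.2 ⟨u, fun h => hne (Subtype.ext h), huv⟩
    rw [← Nat.card_coe_set_eq]
    refine lt_of_le_of_ne (Nat.card_le_card_of_injective _ hinj) fun hc => ?_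
    obtain ⟨u, hu⟩ := ((Nat.bijective_iff_injective_and_card _).2 ⟨hinj, hc⟩).2 ((s d).2 w₀)
    exact u.2 ⟨w₀, fun h => u.2 (h ▸ hw₀), hu.symm⟩
  obtain ⟨loc, mv, ι, hsim, hinj, hι, hocc, -⟩ := hs.exists_simulation W hw₀
    (k := N - Nat.card QB - Wᶜ.ncard) (N := N) (by omega)
  -- Each new process gets an original one with the same final state, whose input it inherits;
  -- processes outside `W` represent at most one new process.
  have hrep (i : Fin N) : ∃ j, loc d i = (s d).2 j ∧ (j ∉ W → ∃ h : j ∈ Wᶜ, ι ⟨j, h⟩ = i) := by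
    by_cases hi : i ∈ Set.range ι
    · obtain ⟨u, rfl⟩ := hi
      exact ⟨u, (hι u d).1, fun _ => ⟨u.2, rfl⟩⟩
    · obtain ⟨t, ht, w, hw, h⟩ := hocc i hi d
      exact ⟨w, by rw [h, hd t ht], fun h => absurd hw h⟩
  choose r hr hrW using hrep
  refine hasGlobalDeadlock_of_reachable (hsim.reachable hs d) (e.1, fun i => e.2 (r i))
    fun p hp => ?_
  cases p with
  | a =>
    obtain ⟨i, hi⟩ := hp.transfer_a
    exact hen _ (hi _ _ rfl rfl ⟨r i, (hr i).symm⟩)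
  | b i =>
    obtain ⟨p, hpi, hi⟩ := hp.transfer_b
    refine hen _ (hi (s d) e (r i) (hr i).symm rfl ?_)
    cases p with
    | a => exact ⟨.a, by simp, rfl⟩
    | b i' =>
      -- Two new processes with a common representative see each other. Such a representative lies
      -- in `W`, so in the original state it also has a partner in the same local state.
      by_cases hii : r i' = r i
      · by_cases hW : r i ∈ W
        · obtain ⟨j, hj, hjr⟩ := hW
          exact ⟨.b j, by simpa using hj, by simp [localState, hr i', hii, hjr]⟩
        · obtain ⟨_, h1⟩ := hrW i hW
          obtain ⟨_, h2⟩ := hrW i' (by rwa [hii])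
          refine absurd ?_ hpi
          rw [← h1, ← h2]; simp only [hii]
      · exact ⟨.b (r i'), by simpa using hii, by simp [localState, hr i']⟩

/-! ### Monotonicity: duplicating one process -/

/-- Every `B`-process `i` of the new system copies the process `ρ i`. -/
theorem IsPath.simulates_copies (hs : IsPath A B s P) {ρ : Fin N → Fin n}
    (hρ : Function.Surjective ρ) :
    Simulates B s P (fun t i => (s t).2 (ρ i)) (fun t i => P t = some (.b (ρ i))) where
  init i := by rw [hs.init]; rfl
  stay t i h := hs.snd_succ h
  move t i h := ⟨ρ i, h, rfl, rfl⟩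
  witness t p j hP hp := by
    obtain ⟨i, rfl⟩ := hρ j
    exact ⟨i, fun h => hp (by simpa [hP] using h), rfl⟩

theorem HasLocalDeadlock.succ (hn : 2 ≤ n) (h : HasLocalDeadlock A B n) :
    HasLocalDeadlock A B (n + 1) := by
  obtain ⟨s, P, T, e, p, hs, hP, hT⟩ := h.exists_path
  have : Nontrivial (Fin n) := Fin.nontrivial_iff_two_le.2 hn
  -- Duplicating the deadlocked process itself could give it a new witness, so another process is
  -- duplicated.
  obtain ⟨w, hw⟩ : ∃ w : Fin n, Proc.b w ≠ p := by
    by_contra! h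
    obtain ⟨i, j, hij⟩ := exists_pair_ne (Fin n)
    exact hij (Proc.b.inj ((h i).trans (h j).symm))
  let ρ : Fin (n + 1) → Fin n := Fin.lastCases w id
  have hρ (i : Fin n) : ρ i.castSucc = i := by simp [ρ]
  have hsim := hs.simulates_copies (ρ := ρ) fun i => ⟨i.castSucc, hρ i⟩
  have hmv (t : ℕ) : P t = some .a ∨ ∃ i, P t = some (.b (ρ i)) := by
    obtain ⟨p, hp⟩ := Option.ne_none_iff_exists'.1 (hP t)
    cases p with
    | a => exact .inl hp
    | b j => exact .inr ⟨j.castSucc, by rw [hρ, hp]⟩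
  have hinf (t : ℕ) : ∃ t' ≥ t, P t' = some .a ∨ ∃ i, P t' = some (.b (ρ i)) := ⟨t, le_rfl, hmv t⟩
  have hstay {t : ℕ} (ht : T ≤ t) := hs.localState_eq (fun t ht => (hT t ht).2) ht
  have hfrom (t : ℕ) (ht : T ≤ t) (f : Fin (n + 1) → QB)
      (hf : ∀ i, f i = (s t).2 (ρ i) ∨ f i = (s (t + 1)).2 (ρ i)) (i : Fin (n + 1)) :
      ∃ t' ≥ T, f i = (s t').2 (ρ i) := by
    rcases hf i with h | h
    · exact ⟨t, ht, h⟩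
    · exact ⟨t + 1, by omega, h⟩
  cases p with
  | a =>
    refine hsim.hasLocalDeadlock hs (e.1, fun i => e.2 (ρ i)) .a T (fun t ht f hf hen => ?_) ?_ hinf
    · obtain ⟨i, hi⟩ := hen.transfer_a
      obtain ⟨t', ht', h⟩ := hfrom t ht f hf i
      refine (hT t' ht').1 (hi _ _ ?_ rfl ⟨ρ i, h.symm⟩)
      simpa [localState] using (hstay ht').trans (hstay ht).symm
    · rintro t ht p' (⟨h, -⟩ | ⟨i, -, rfl⟩)
      · exact absurd h (hT t ht).2
      · simp
  | b d =>
    have hd (i : Fin (n + 1)) (hi : ρ i = d) : i = d.castSucc := by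
      induction i using Fin.lastCases with
      | last => exact absurd (by simpa [ρ] using hi) fun h => hw (by rw [h])
      | cast i => rw [← hi, hρ]
    refine hsim.hasLocalDeadlock hs (e.1, fun i => e.2 (ρ i)) (.b d.castSucc) T
      (fun t ht f hf hen => ?_) ?_ hinf
    · have hfd {t' : ℕ} (ht' : T ≤ t') : (s t').2 d = f d.castSucc := by
        obtain ⟨t'', ht'', h⟩ := hfrom t ht f hf d.castSucc
        rw [h, hρ]
        simpa [localState] using (hstay ht').trans (hstay ht'').symm
      obtain ⟨p, hp, hi⟩ := hen.transfer_b
      cases p with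
      | a => exact (hT t ht).1 (hi _ _ d (hfd ht) (by simp [hρ]) ⟨.a, by simp, rfl⟩)
      | b i =>
        obtain ⟨t', ht', h⟩ := hfrom t ht f hf i
        refine (hT t' ht').1 (hi _ _ d (hfd ht') (by simp [hρ]) ⟨.b (ρ i), fun h => hp ?_, ?_⟩)
        · rw [hd i (Proc.b.inj h)]
        · simp [localState, h]
    · rintro t ht p' (⟨-, rfl⟩ | ⟨i, hi, rfl⟩)
      · simp
      · intro h
        rw [Proc.b.inj h, hρ] at hi
        exact (hT t ht).2 hi

end

section

variable {QA QB IA IB : Type*} {n N : ℕ}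
variable {A : Template QA IA (QA ⊕ QB)} {B : Template QB IB (QA ⊕ QB)}
variable {s : ℕ → State QA QB n} {P : ℕ → Option (Proc n)}

theorem HasGlobalDeadlock.succ [Finite QB] (hn : Nat.card QB < n)
    (h : HasGlobalDeadlock A B n) : HasGlobalDeadlock A B (n + 1) := by
  obtain ⟨s, P, d, e, hs, -, hen⟩ := h.exists_path
  -- By pigeonhole, some final state is already shared. A duplicate of `w` then offers `w` no
  -- witness that `v` does not offer.
  obtain ⟨v, w, hvw, hvw'⟩ : ∃ v w, v ≠ w ∧ (s d).2 v = (s d).2 w := by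
    by_contra! h
    have hinj : Function.Injective (s d).2 := fun i j hij => by
      by_contra hne
      exact h i j hne hij
    have := Nat.card_le_card_of_injective _ hinj
    rw [Nat.card_fin] at this
    omega
  let ρ : Fin (n + 1) → Fin n := Fin.lastCases w id
  have hρ (i : Fin n) : ρ i.castSucc = i := by simp [ρ]
  have hρ' : ρ (Fin.last n) = w := by simp [ρ]
  have hw {i i' : Fin (n + 1)} (hne : i ≠ i') (h : ρ i = ρ i') : ρ i = w := by
    induction i using Fin.lastCases with
    | last => exact hρ'
    | cast i =>
      induction i' using Fin.lastCases with
      | last => rw [h, hρ']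
      | cast i' => rw [hρ, hρ] at h; exact absurd (by rw [h]) hne
  have hsim := hs.simulates_copies (ρ := ρ) fun i => ⟨i.castSucc, hρ i⟩
  refine hasGlobalDeadlock_of_reachable (hsim.reachable hs d) (e.1, fun i => e.2 (ρ i))
    fun p hp => ?_
  cases p with
  | a =>
    obtain ⟨i, hi⟩ := hp.transfer_a
    exact hen _ (hi _ _ rfl rfl ⟨ρ i, rfl⟩)
  | b i =>
    obtain ⟨p, hpi, hi⟩ := hp.transfer_b
    refine hen _ (hi (s d) e (ρ i) rfl rfl ?_)
    cases p with
    | a => exact ⟨.a, by simp, rfl⟩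
    | b i' =>
      by_cases hii : ρ i' = ρ i
      · have h1 := hw (fun h => hpi (by rw [h])) hii
        refine ⟨.b v, ?_, by simp [localState, h1, hvw']⟩
        rw [← hii, h1]
        simpa using hvw
      · exact ⟨.b (ρ i'), by simpa using hii, rfl⟩

/-! ### Templates `B` with one or two states -/

/-- A local deadlock may turn into a global one here: if `A` is stuck, the single `B`-process either
loops forever or is stuck as well. If a `B`-process is stuck, only `A` can move infinitely often,
since all `B`-processes share state and input. -/
theorem HasLocalDeadlock.hasDeadlock_one [Subsingleton QB] [Subsingleton IB] (hn : 2 ≤ n)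
    (h : HasLocalDeadlock A B n) : HasDeadlock A B 1 := by
  obtain ⟨s, P, T, e, p, hs, hP, hT⟩ := h.exists_path
  have hsim : Simulates (N := 1) B s P (fun _ _ => B.init) fun _ _ => False :=
    ⟨fun _ => rfl, fun _ _ _ => rfl, fun _ _ h => h.elim,
      fun _ _ _ _ _ => ⟨0, id, Subsingleton.elim _ _⟩⟩
  cases p with
  | a =>
    let e' : Input IA IB 1 := (e.1, fun _ => e.2 ⟨0, by omega⟩)
    let y : State QA QB 1 := ((s T).1, fun _ => B.init)
    have hy : Reachable A B y := hsim.reachable hs T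
    have ha : ¬ Enabled A B y e' .a := fun h => by
      obtain ⟨i, hi⟩ := h.transfer_a
      exact (hT T le_rfl).1 (hi _ _ rfl rfl ⟨⟨0, by omega⟩, Subsingleton.elim _ _⟩)
    by_cases hb : Enabled A B y e' (.b 0)
    · obtain ⟨g, q', htr, hg⟩ := hb
      exact .inl (hasLocalDeadlock_of_chain (z := fun _ => y) e' .a hy fun _ =>
        ⟨.b 0, ⟨ha, by simp⟩, _, g, q', htr, hg, Prod.ext rfl (Subsingleton.elim _ _)⟩)
    · refine .inr (hasGlobalDeadlock_of_reachable hy e' fun p => ?_)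
      cases p with
      | a => exact ha
      | b i => rwa [Subsingleton.elim i 0]
  | b d =>
    obtain ⟨p, hp⟩ := exists_frequently_mover hP
    cases p with
    | a =>
      refine .inl (hsim.hasLocalDeadlock hs (e.1, fun _ => e.2 d) (.b 0) T
        (fun t ht f _ hen => ?_) ?_ fun t => ?_)
      · obtain ⟨p, hp, hi⟩ := hen.transfer_b
        cases p with
        | a => exact (hT t ht).1 (hi _ _ d (Subsingleton.elim _ _) rfl ⟨.a, by simp, rfl⟩)
        | b i => exact hp (by rw [Subsingleton.elim i 0])
      · rintro t ht p' (⟨-, rfl⟩ | ⟨i, h, -⟩)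
        · simp
        · exact h.elim
      · obtain ⟨t', ht', h⟩ := hp t
        exact ⟨t', ht', .inl h⟩
    | b j =>
      obtain ⟨t, ht, hPt⟩ := hp T
      have hj : j ≠ d := by
        rintro rfl
        exact (hT t ht).2 hPt
      obtain ⟨σ, g, q', htr, ⟨p', hp', hg⟩, -⟩ := hs.move t _ hPt
      refine absurd ?_ (hT t ht).1
      refine ⟨g, q', ?_, ?_⟩
      · rwa [Subsingleton.elim ((s t).2 d) ((s t).2 j), Subsingleton.elim (e.2 d) σ]
      · cases p' with
        | a => exact ⟨.a, by simp, hg⟩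
        | b i =>
          refine ⟨.b j, by simpa using hj, ?_⟩
          have : (s t).2 j = (s t).2 i := Subsingleton.elim _ _
          simpa only [localState, this] using hg

/-- If all processes other than `d` are eventually in the same state, then three processes are
enough for a local deadlock of `d`. -/
theorem IsPath.hasLocalDeadlock_three_of_eventually (hs : IsPath A B s P) (hQ : Nat.card QB = 2)
    {T : ℕ} {e : Input IA IB n} {d j : Fin n}
    (hT : ∀ t ≥ T, ¬ Enabled A B (s t) e (.b d) ∧ P t ≠ some (.b d))
    (hj : ∀ t, ∃ t' ≥ t, P t' = some (.b j)) {q : QB} {T' : ℕ}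
    (hq : ∀ t ≥ T', ∀ w ≠ d, (s t).2 w = q) : HasLocalDeadlock A B 3 := by
  classical
  have : Finite QB := Nat.finite_of_card_ne_zero (by omega)
  obtain ⟨t, ht, hPt⟩ := hj (max T T')
  have htT : T ≤ t := le_trans (le_max_left _ _) ht
  have htT' : T' ≤ t := le_trans (le_max_right _ _) ht
  have hjd : j ≠ d := by
    rintro rfl
    exact (hT t htT).2 hPt
  obtain ⟨loc, mv, ι, hsim, hinj, hι, hocc, -⟩ := hs.exists_simulation {d}ᶜ (w₀ := j)
    (by simpa using hjd) (k := 0) (N := 3) (by rw [compl_compl, Set.ncard_singleton, hQ])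
  let u : ↥({d}ᶜᶜ : Set (Fin n)) := ⟨d, by simp⟩
  have hloc (i : Fin 3) (hi : i ≠ ι u) : loc t i = q := by
    have hi' : i ∉ Set.range ι := by
      rintro ⟨v, rfl⟩
      have : v = u := Subtype.ext (by simpa using v.2)
      exact hi (by rw [this])
    obtain ⟨t', ht', w, hw, h⟩ := hocc i hi' t
    rw [h, hq t' (htT'.trans ht') w (by simpa using hw)]
  have hthird : ∀ i i' : Fin 3, ∃ i'', i'' ≠ i ∧ i'' ≠ i' := by decide
  obtain ⟨i, hi, -⟩ := hthird (ι u) (ι u)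
  obtain ⟨i', hi', hii⟩ := hthird (ι u) i
  refine hasLocalDeadlock_of_chain (z := fun _ => ((s t).1, loc t)) (e.1, fun _ => e.2 d) (.b (ι u))
    (hsim.reachable hs t) fun _ => ⟨.b i, ⟨fun hen => ?_, by simpa using hi⟩, ?_⟩
  · obtain ⟨p, hp, h⟩ := hen.transfer_b
    refine (hT t htT).1 (h _ _ d (hι u t).1.symm rfl ?_)
    cases p with
    | a => exact ⟨.a, by simp, rfl⟩
    | b i =>
      refine ⟨.b j, by simpa using hjd, ?_⟩
      simp [localState, hq t htT' j hjd, hloc i (fun h => hp (by rw [h]))]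
  · obtain ⟨σ, g, q', htr, ⟨p', hp', hg⟩, h⟩ := hs.move t _ hPt
    -- The move of `j` is a self-loop at `q`, so it can be repeated forever by one of the two
    -- processes in `q`, the other serving as its witness.
    have hq' : q' = q := by
      have := hq (t + 1) (by omega) j hjd
      simpa [h] using this
    refine ⟨σ, g, q', ?_, ?_, ?_⟩
    · simpa only [hloc i hi, hq t htT' j hjd] using htr
    · cases p' with
      | a => exact ⟨.a, by simp, hg⟩
      | b j' =>
        by_cases hj' : j' = d
        · subst hj'
          exact ⟨.b (ι u), by simpa using hi.symm, by simpa only [localState, (hι u t).1] using hg⟩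
        · refine ⟨.b i', by simpa using hii, ?_⟩
          simpa only [localState, hloc i' hi', hq t htT' j' hj'] using hg
    · rw [hq', ← hloc i hi]
      simp

/-- Flooding without evacuation: each process stops for good in its target. As the targets cover
`QB`, every occupied state has a resting guard. -/
theorem IsPath.reachable_of_surjective (hs : IsPath A B s P) {τ : Fin N → QB}
    (hτ : Function.Surjective τ) (hvis : ∀ r, ∃ t j, (s t).2 j = r) (T : ℕ) :
    ∃ t ≥ T, Reachable A B ((s t).1, τ) := by
  have h (i : Fin N) := hs.exists_flooding (W := Set.univ) (r := τ i) (by simpa using hvis (τ i))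
  choose l m t₁ hf hlt hge _ using h
  have hsim : Simulates B s P (fun t i => l i t) fun t i => m i t := by
    refine ⟨fun i => (hf i).init, fun t i => (hf i).stay t, fun t i hi => ?_, fun t p j hP hp => ?_⟩
    · obtain ⟨j, -, h⟩ := (hf i).move t hi
      exact ⟨j, h⟩
    · obtain ⟨i, hi⟩ := hτ ((s t).2 j)
      have ht : t₁ i ≤ t := by
        by_contra! h
        exact hlt i t h j trivial hi.symm
      exact ⟨i, (hge i t ht).2, by rw [(hge i t ht).1, hi]⟩
  obtain ⟨M, hM⟩ := (Set.finite_range t₁).bddAbove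
  refine ⟨max T M, le_max_left _ _, ?_⟩
  convert hsim.reachable hs (max T M) using 2
  funext i
  exact ((hge i _ ((hM ⟨i, rfl⟩).trans (le_max_right _ _))).1).symm

/-- If both local states of `B` are visited infinitely often by processes other than `d`, then a
deadlock of `d` does not depend on the other `B`-processes. -/
theorem IsPath.hasLocalDeadlock_three_of_frequently (hs : IsPath A B s P) (hQ : Nat.card QB = 2)
    {T : ℕ} {e : Input IA IB n} {d j : Fin n}
    (hT : ∀ t ≥ T, ¬ Enabled A B (s t) e (.b d) ∧ P t ≠ some (.b d))
    (hj : ∀ t, ∃ t' ≥ t, P t' = some (.b j)) (ha : ∀ t ≥ T, P t ≠ some .a)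
    (hq : ∀ q t, ∃ t' ≥ t, ∃ w ≠ d, (s t').2 w = q) : HasLocalDeadlock A B 3 := by
  obtain ⟨x, y, hxy, huniv⟩ := Nat.card_eq_two_iff.1 hQ
  have hxy' (r : QB) : r = x ∨ r = y := by simpa using huniv.symm.subset (Set.mem_univ r)
  set α := (s T).1
  set qd := (s T).2 d
  obtain ⟨q', hq'⟩ : ∃ q', ∀ r, r = qd ∨ r = q' := by
    rcases hxy' qd with h | h
    · exact ⟨y, fun r => h ▸ hxy' r⟩
    · exact ⟨x, fun r => h ▸ (hxy' r).symm⟩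
  have hα {t : ℕ} (ht : T ≤ t) : (s t).1 = α := by
    simpa [localState] using hs.localState_eq ha ht
  have hqd {t : ℕ} (ht : T ≤ t) : (s t).2 d = qd := by
    simpa [localState] using hs.localState_eq (fun t ht => (hT t ht).2) ht
  -- Processes 0 and 2 rest in the two states of `B` and satisfy any guard that the original
  -- `B`-processes could; process 1 copies `j`, and process 0 is the deadlocked one.
  let Y (t : ℕ) : State QA QB 3 := (α, ![qd, (s (T + t)).2 j, q'])
  let e' : Input IA IB 3 := (e.1, fun _ => e.2 d)
  have hdis (t : ℕ) : ¬ Enabled A B (Y t) e' (.b 0) := fun hen => by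
    obtain ⟨p, hp, hi⟩ := hen.transfer_b
    cases p with
    | a => exact (hT T le_rfl).1 (hi _ _ d rfl rfl ⟨.a, by simp, rfl⟩)
    | b i =>
      obtain ⟨t', ht', w, hw, h⟩ := hq ((Y t).2 i) T
      exact (hT t' ht').1 (hi _ _ d (hqd ht') rfl ⟨.b w, by simpa using hw, by simp [localState, h]⟩)
  have hmove (t : ℕ) (hPt : P (T + t) = some (.b j)) :
      StuckMove A B e' (.b 0) (Y t) (Y (t + 1)) := by
    obtain ⟨σ, g, q'', htr, ⟨p', hp', hg⟩, h⟩ := hs.move _ _ hPt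
    refine ⟨.b 1, ⟨hdis t, by simp⟩, σ, g, q'', htr, ?_, ?_⟩
    · cases p' with
      | a =>
        refine ⟨.a, by simp, ?_⟩
        simpa [localState, Y, hα (Nat.le_add_right T t)] using hg
      | b i =>
        rcases hq' ((s (T + t)).2 i) with h | h
        · exact ⟨.b 0, by simp, by simpa [localState, Y, h] using hg⟩
        · exact ⟨.b 2, by simp, by simpa [localState, Y, h] using hg⟩
    · have : (s (T + (t + 1))).2 j = q'' := by rw [← add_assoc, h]; simp
      refine Prod.ext rfl (funext fun i => ?_)
      fin_cases i <;> simp [Y, this]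
  obtain ⟨z, hz0, hz⟩ := exists_chain_of_frequently (Y := Y) (R := StuckMove A B e' (.b 0))
    (fun t => by
      by_cases hPt : P (T + t) = some (.b j)
      · exact .single (hmove t hPt)
      · have : Y (t + 1) = Y t := by simp only [Y, ← add_assoc, hs.snd_succ hPt]
        rw [this])
    (fun t => by
      obtain ⟨t', ht', h⟩ := hj (T + t)
      obtain ⟨k, rfl⟩ := Nat.exists_eq_add_of_le (show T ≤ t' by omega)
      exact ⟨k, by omega, .single (hmove k h)⟩)
  refine hasLocalDeadlock_of_chain e' (.b 0) ?_ hz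
  have hsurj : Function.Surjective ![qd, (s (T + 0)).2 j, q'] := fun r => by
    rcases hq' r with h | h
    · exact ⟨0, h.symm⟩
    · exact ⟨2, h.symm⟩
  obtain ⟨t, ht, hr⟩ := hs.reachable_of_surjective hsurj
    (fun r => (hq r 0).imp fun t h => h.2.imp fun w h => h.2) T
  rw [hα ht] at hr
  rwa [hz0]

/-- The general bound gives four processes. The fourth is needed only if a `B`-process is stuck and
`A` eventually rests; then the processes other than `d` either visit both states forever or
eventually all sit in one. -/
theorem HasLocalDeadlock.three (hn : 2 ≤ n) (hQ : Nat.card QB = 2) (h : HasLocalDeadlock A B n) :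
    HasLocalDeadlock A B 3 := by
  have : Finite QB := Nat.finite_of_card_ne_zero (by omega)
  obtain ⟨s, P, T, e, p, hs, hP, hT⟩ := h.exists_path
  cases p with
  | a => exact hs.hasLocalDeadlock_a hP hT (by omega)
  | b d =>
    by_cases ha : ∀ t, ∃ t' ≥ t, P t' = some .a
    · have : Nontrivial (Fin n) := Fin.nontrivial_iff_two_le.2 hn
      obtain ⟨w₀, hw₀⟩ := exists_ne d
      exact hs.hasLocalDeadlock_b (k := 0) hT hw₀ (.inl ha) (by omega)
    obtain ⟨p, hp⟩ := exists_frequently_mover hP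
    cases p with
    | a => exact absurd hp ha
    | b j =>
      by_cases hq : ∀ q t, ∃ t' ≥ t, ∃ w ≠ d, (s t').2 w = q
      · push Not at ha
        obtain ⟨T', hT'⟩ := ha
        exact hs.hasLocalDeadlock_three_of_frequently hQ (T := max T T')
          (fun t ht => hT t (le_trans (le_max_left _ _) ht)) hp
          (fun t ht => hT' t (le_trans (le_max_right _ _) ht)) hq
      · push Not at hq
        obtain ⟨q, T', hT'⟩ := hq
        obtain ⟨x, y, hxy, huniv⟩ := Nat.card_eq_two_iff.1 hQ
        have hxy' (r : QB) : r = x ∨ r = y := by simpa using huniv.symm.subset (Set.mem_univ r)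
        rcases hxy' q with rfl | rfl
        · exact hs.hasLocalDeadlock_three_of_eventually hQ hT hp
            fun t ht w hw => (hxy' _).resolve_left (hT' t ht w hw)
        · exact hs.hasLocalDeadlock_three_of_eventually hQ hT hp
            fun t ht w hw => (hxy' _).resolve_right (hT' t ht w hw)

theorem HasDeadlock.of_card [Finite QB] (hB : 2 ≤ Nat.card QB ∨ Subsingleton IB)
    (hn : 2 * Nat.card QB - 1 < n) (h : HasDeadlock A B n) :
    HasDeadlock A B (2 * Nat.card QB - 1) := by
  have : Nonempty QB := ⟨B.init⟩
  have hpos : 0 < Nat.card QB := Nat.card_pos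
  rcases h with h | h
  · obtain h3 | h2 | h1 : 3 ≤ Nat.card QB ∨ Nat.card QB = 2 ∨ Nat.card QB = 1 := by omega
    · exact .inl (h.of_card_add_two_le (by omega) (by omega))
    · rw [h2]; exact .inl (h.three (by omega) h2)
    · have hI : Subsingleton IB := hB.resolve_left (by omega)
      have hQ : Subsingleton QB := (Nat.card_eq_one_iff_unique.1 h1).1
      rw [h1]; exact h.hasDeadlock_one (by omega)
  · exact .inr (h.of_two_mul_card_le (by omega) le_rfl)

theorem HasDeadlock.succ [Finite QB] (hn : Nat.card QB < n) (h : HasDeadlock A B n) :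
    HasDeadlock A B (n + 1) := by
  have : Nonempty QB := ⟨B.init⟩
  have hpos : 0 < Nat.card QB := Nat.card_pos
  exact h.imp (fun h => h.succ (by omega)) fun h => h.succ hn

theorem isDeadlockCutoff [Finite QB] (hB : 2 ≤ Nat.card QB) :
    IsDeadlockCutoff A B (2 * Nat.card QB - 1) := by
  refine ⟨by omega, fun n hn => ⟨fun h => ?_, fun h => ?_⟩⟩
  · induction n, hn using Nat.le_induction with
    | base => exact h
    | succ n hn ih => exact ih.succ (by omega)
  · rcases hn.eq_or_lt with rfl | hn
    · exact h
    · exact h.of_card (.inl hB) hn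

end

/-! ### Asymptotic tightness -/

/-- The `A`-template that can move forever until it sees the last of the `m + 2` states of `B`; it
may then go to the dead state `false`. -/
def tightA (m : ℕ) : Template Bool Unit (Bool ⊕ Fin (m + 2)) where
  init := true
  trans q _ g q' := q = true ∧
    (q' = true ∧ g = Set.range Sum.inr ∨ q' = false ∧ g = {.inr (Fin.last _)})

/-- The `B`-template in which a process may stay where it is as long as `A` is not dead, and may
advance if another process is in the same state. -/
def tightB (m : ℕ) : Template (Fin (m + 2)) Unit (Bool ⊕ Fin (m + 2)) where
  init := 0
  trans q _ g q' := q' = q ∧ g = {.inl true} ∨ q'.val = q.val + 1 ∧ g = {.inr q}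

/-- `A` is not dead, and the states occupied by `B`-processes form an initial segment. -/
def TightInvariant {m n : ℕ} (s : State Bool (Fin (m + 2)) n) : Prop :=
  s.1 = true ∧ ∀ j, ∀ i ≤ s.2 j, ∃ j', s.2 j' = i

theorem TightInvariant.move {m : ℕ} {s s' : State Bool (Fin (m + 2)) (m + 1)}
    {p : Proc (m + 1)} (hs : TightInvariant s) (h : Move (tightA m) (tightB m) s p s') :
    TightInvariant s' := by
  cases p with
  | a =>
    obtain ⟨σ, g, q', ⟨-, ⟨rfl, rfl⟩ | ⟨rfl, rfl⟩⟩, ⟨p', hp', hg⟩, rfl⟩ := h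
    · exact ⟨rfl, hs.2⟩
    · exfalso
      cases p' with
      | a => exact hp' rfl
      | b j =>
        have hj : s.2 j = Fin.last _ := by simpa [localState] using hg
        -- A process in the last state forces all `m + 2` states to be occupied, by only `m + 1`
        -- processes.
        have hsurj : Function.Surjective s.2 := fun i => hs.2 j i (hj ▸ Fin.le_last i)
        have := Fintype.card_le_of_surjective _ hsurj
        simp at this
  | b j =>
    obtain ⟨σ, g, q', ⟨rfl, -⟩ | ⟨hq', rfl⟩, ⟨p', hp', hg⟩, rfl⟩ := h
    · simpa using hs
    · refine ⟨hs.1, ?_⟩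
      obtain ⟨j', hj', hjj⟩ : ∃ j', j' ≠ j ∧ s.2 j' = s.2 j := by
        cases p' with
        | a => simp [localState] at hg
        | b j' => exact ⟨j', by simpa using hp', by simpa [localState] using hg⟩
      have hocc (i : Fin (m + 2)) (j₁ : Fin (m + 1)) (hi : i ≤ s.2 j₁) :
          ∃ j', Function.update s.2 j q' j' = i := by
        obtain ⟨j₂, h₂⟩ := hs.2 j₁ i hi
        by_cases h : j₂ = j
        · subst h; exact ⟨j', by simp [hj', hjj, h₂]⟩
        · exact ⟨j₂, by simp [h, h₂]⟩
      intro j₁ i hi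
      by_cases h : j₁ = j
      · subst h
        simp only [Function.update_self] at hi
        rcases hi.eq_or_lt with rfl | hi
        · exact ⟨j₁, by simp⟩
        · refine hocc i j₁ ?_
          rw [Fin.lt_def] at hi
          rw [Fin.le_def]; omega
      · simp only [Function.update_of_ne h] at hi
        exact hocc i j₁ hi

theorem TightInvariant.enabled {m : ℕ} {s : State Bool (Fin (m + 2)) (m + 1)}
    (hs : TightInvariant s) (e : Input Unit Unit (m + 1)) (p : Proc (m + 1)) :
    Enabled (tightA m) (tightB m) s e p := by
  cases p with
  | a => exact ⟨_, _, ⟨hs.1, .inl ⟨rfl, rfl⟩⟩, .b 0, by simp, by simp [localState]⟩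
  | b j => exact ⟨_, _, .inl ⟨rfl, rfl⟩, .a, by simp, by simp [localState, hs.1]⟩

theorem not_hasDeadlock_tight (m : ℕ) : ¬ HasDeadlock (tightA m) (tightB m) (m + 1) := by
  have hinv {s : ℕ → State Bool (Fin (m + 2)) (m + 1)} {P : ℕ → Option (Proc (m + 1))}
      (hs : IsPath (tightA m) (tightB m) s P) (t : ℕ) : TightInvariant (s t) := by
    induction t with
    | zero =>
      rw [hs.init]
      refine ⟨rfl, fun j i hi => ⟨j, (le_antisymm hi (Fin.zero_le _)).symm⟩⟩
    | succ t ih =>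
      rcases hP : P t with _ | p
      · rwa [hs.pause t hP]
      · exact ih.move (hs.move t p hP)
  rintro (h | h)
  · obtain ⟨s, P, T, e, p, hs, -, hT⟩ := h.exists_path
    exact (hT T le_rfl).1 ((hinv hs T).enabled e p)
  · obtain ⟨s, P, d, e, hs, -, hd⟩ := h.exists_path
    exact hd .a ((hinv hs d).enabled e .a)

/-- In round `t`, the processes of index above `t` advance from state `t` one after another, while
process `t` stays behind as their witness. -/
theorem reachable_tight (m t : ℕ) : Reachable (tightA m) (tightB m)
    (true, fun j : Fin (m + 2) => (⟨min j t, by omega⟩ : Fin (m + 2))) := by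
  induction t with
  | zero =>
    have : (true, fun j : Fin (m + 2) => (⟨min j 0, by omega⟩ : Fin (m + 2))) =
        initState (tightA m) (tightB m) (m + 2) :=
      Prod.ext rfl (funext fun j => Fin.ext (by simp [initState, tightB]))
    rw [this]; exact .refl
  | succ t ih =>
    -- The state within a round after the processes of index at least `l` have had their turn,
    -- highest index first; for `l ≤ t` nothing changes any more.
    let f (l : ℕ) (j : Fin (m + 2)) : Fin (m + 2) :=
      ⟨if l ≤ j then min j (t + 1) else min j t, by split <;> omega⟩
    have hf (c : ℕ) : Reachable (tightA m) (tightB m) (true, f (m + 2 - c)) := by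
      induction c with
      | zero =>
        convert ih using 2
        funext j
        have : ¬ m + 2 ≤ j.val := by omega
        simp [f, this]
      | succ c ihc =>
        set l := m + 2 - (c + 1)
        by_cases hl : c < m + 2 ∧ t < l
        · have hc : m + 2 - c = l + 1 := by omega
          rw [hc] at ihc
          have hlm : l < m + 2 := by omega
          have htm : t < m + 2 := by omega
          have h1 : f (l + 1) ⟨l, hlm⟩ = ⟨t, htm⟩ := by ext; simp [f]; omega
          have h2 : f (l + 1) ⟨t, htm⟩ = ⟨t, htm⟩ := by ext; simp [f]
          refine ihc.tail ⟨.b ⟨l, hlm⟩, trivial, (), _, ⟨t + 1, by omega⟩,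
            .inr ⟨by simp [h1], rfl⟩, ⟨.b ⟨t, htm⟩, ?_, ?_⟩, ?_⟩
          · simp; omega
          · simp [localState, h1, h2]
          · refine Prod.ext rfl (funext fun j => ?_)
            by_cases hj : j = ⟨l, hlm⟩
            · subst hj; ext; simp [f]; omega
            · have hj' : j.val ≠ l := fun h => hj (Fin.ext h)
              have : l ≤ j.val ↔ l + 1 ≤ j.val := by omega
              simp [f, hj, this]
        · convert ihc using 2
          funext j
          ext
          simp only [f]
          split <;> split <;> omega
    convert hf (m + 2) using 2
    funext j
    simp [f]

theorem hasDeadlock_tight (m : ℕ) : HasDeadlock (tightA m) (tightB m) (m + 2) := by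
  have hr : Reachable (tightA m) (tightB m) (true, fun j : Fin (m + 2) => j) := by
    convert reachable_tight m (m + 1) using 2
    funext j
    ext
    simp; omega
  refine .inr (hasGlobalDeadlock_of_reachable (s := (false, fun j => j))
    (hr.tail ⟨.a, trivial, (), _, false, ⟨rfl, .inr ⟨rfl, rfl⟩⟩,
      ⟨.b (Fin.last _), by simp, by simp [localState]⟩, rfl⟩) ((), fun _ => ()) fun p hp => ?_)
  cases p with
  | a =>
    obtain ⟨g, q', ⟨h, -⟩, -⟩ := hp
    simp at h
  | b j =>
    obtain ⟨g, q', ⟨-, rfl⟩ | ⟨-, rfl⟩, p', hp', hg⟩ := hp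
    · cases p' <;> simp [localState] at hg
    · cases p' with
      | a => simp [localState] at hg
      | b j' => exact hp' (by simpa [localState] using hg)

end GuardedSystem

theorem mainTheorem7 :
    (∀ (QA QB IA IB : Type*) [Finite QA] [Finite QB] [Finite IA] [Finite IB]
        (A : GuardedSystem.Template QA IA (QA ⊕ QB))
        (B : GuardedSystem.Template QB IB (QA ⊕ QB)),
      -- bounding, local deadlocks
      (∀ n > Nat.card QB + 2, GuardedSystem.HasLocalDeadlock A B n →
        GuardedSystem.HasLocalDeadlock A B (Nat.card QB + 2)) ∧
      -- bounding, global deadlocks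
      (∀ n > 2 * Nat.card QB - 1, GuardedSystem.HasGlobalDeadlock A B n →
        GuardedSystem.HasGlobalDeadlock A B (2 * Nat.card QB - 1)) ∧
      -- bounding, deadlocks
      (2 ≤ Nat.card QB ∨ Subsingleton IB →
        ∀ n > 2 * Nat.card QB - 1, GuardedSystem.HasDeadlock A B n →
          GuardedSystem.HasDeadlock A B (2 * Nat.card QB - 1)) ∧
      -- monotonicity
      (∀ n ≥ Nat.card QB + 1, GuardedSystem.HasDeadlock A B n →
        GuardedSystem.HasDeadlock A B (n + 1)) ∧
      -- the cutoff for deadlock detection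
      (2 ≤ Nat.card QB → GuardedSystem.IsDeadlockCutoff A B (2 * Nat.card QB - 1))) ∧
    -- asymptotic tightness: no cutoff below the size of `B` works for all templates
    (∀ k : ℕ, 2 ≤ k → ∃ (QA QB IA IB : Type) (_ : Finite QA) (_ : Finite QB)
        (_ : Finite IA) (_ : Finite IB)
        (A : GuardedSystem.Template QA IA (QA ⊕ QB))
        (B : GuardedSystem.Template QB IB (QA ⊕ QB)),
      Nat.card QB = k ∧
      ¬ GuardedSystem.HasDeadlock A B (k - 1) ∧ GuardedSystem.HasDeadlock A B k ∧
      ∀ c, GuardedSystem.IsDeadlockCutoff A B c → k ≤ c) := by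
  refine ⟨fun QA QB IA IB _ _ _ _ A B => ⟨fun n hn h => h.of_card_add_two_le (by omega) le_rfl,
    fun n hn h => ?_, fun hB n hn h => h.of_card hB hn, fun n hn h => h.succ (by omega),
    fun hB => GuardedSystem.isDeadlockCutoff hB⟩, fun k hk => ?_⟩
  · have : Nonempty QB := ⟨B.init⟩
    have hpos : 0 < Nat.card QB := Nat.card_pos
    exact h.of_two_mul_card_le (by omega) le_rfl
  · obtain ⟨m, rfl⟩ := Nat.exists_eq_add_of_le' hk
    have hno := GuardedSystem.not_hasDeadlock_tight m
    have hyes := GuardedSystem.hasDeadlock_tight m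
    refine ⟨Bool, Fin (m + 2), Unit, Unit, inferInstance, inferInstance, inferInstance,
      inferInstance, GuardedSystem.tightA m, GuardedSystem.tightB m, Nat.card_fin _, hno, hyes,
      fun c hc => ?_⟩
    by_contra! hlt
    exact hno ((hc.2 (m + 1) (by omega)).1 ((hc.2 (m + 2) (by omega)).2 hyes))
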